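/- Let $(E,\mathscr{T},\le)$ be a topological space with a preorder (a reflexive and transitive relation). Assume that $E$ is Tychonoff and that $\le$ has closed graph in $E\times E$. A map $f$ is isotone if $x\le y$ implies $f(x)\le f(y)$. Write $x\sim y$ for "$x\le y$ and $y\le x$", and let $\pi:E\to E/{\sim}$ be the projection onto the quotient space, endowed with the quotient topology and the order $[x]\lesssim[y]\iff x\le y$. Assume that $E/{\sim}$ is completely regularly ordered: its topology is the initial topology generated by the continuous isotone functions $E/{\sim}\to[0,1]$, and $a\lesssim b$ if and only if $f(a)\le f(b)$ for all such functions $f$. A $T_2$-preorder compactification of a topological preordered space $X$ is a map $c:X\to Y$ into a compact topological preordered space $Y$ whose preorder has closed graph, such that $c$ has dense image, is a homeomorphism onto its image and satisfies $x\le y\iff c(x)\le c(y)$. It is a $T_2$-order compactification if the preorder of $Y$ is antisymmetric (then $Y$ is Hausdorff). Two compactifications $c_1:X\to Y_1$ and $c_2:X\to Y_2$ are equivalent if there are continuous isotone maps $C:Y_2\to Y_1$ and $D:Y_1\to Y_2$ with $C\circ c_2=c_1$ and $D\circ c_1=c_2$. Let $\beta:E\to\beta E$ be the Stone–Čech compactification,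 with the preorder $a\le_\beta b$ if and only if $\tilde f(a)\le\tilde f(b)$ for every continuous isotone $f:E\to[0,1]$, where $\tilde f:\beta E\to[0,1]$ is the continuous extension of $f$. Let $\sim_\beta$ be the associated equivalence relation and $\Pi:\beta E\to\beta E/{\sim_\beta}$ the projection onto the quotient, with the quotient topology and quotient order. For a topological preordered space $X$, Nachbin's compactification $n:X\to nX$ is the map $x\mapsto (f(x))_f$ into the cube $[0,1]^{\mathcal F(X)}$, where $\mathcal F(X)$ is the set of continuous isotone functions $X\to[0,1]$ and $nX$ is the closure of the image, with the topology and order induced from the product. Then: 1. The preorder of $E$ is represented by continuous isotone functions: $x\le y$ if and only if $f(x)\le f(y)$ for all continuous isotone $f:E\to[0,1]$. Moreover, $\beta:E\to\beta E$, with the preorder $\le_\beta$, is a Hausdorff $T_2$-preorder compactification of $E$. 2. $\varphi=\Pi\circ\beta\circ\pi^{-1}:E/{\sim}\to\beta E/{\sim_\beta}$, $[x]\mapsto\Pi(\beta(x))$, is a well-defined map, and it is a $T_2$-order compactification of $E/{\sim}$. 3. Nachbin's map $n:E/{\sim}\to n(E/{\sim})$ is a $T_2$-order compactification of $E/{\sim}$,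 and $\varphi$ is equivalent to it. 4. The square formed by $\beta,\pi,\Pi,n$ commutes up to equivalence: there is a homeomorphism $H:\beta E/{\sim_\beta}\to n(E/{\sim})$, isotone together with its inverse, such that $H\circ\varphi=n$ and hence $H\circ\Pi\circ\beta=n\circ\pi$. -/

import Mathlib

open Topology

/-- A topological preordered space is completely regularly preordered if its topology is the
initial topology generated by the continuous isotone functions into `[0,1]`, and these functions
determine the preorder.  When the preorder is antisymmetric one speaks of a completely regularly
ordered space. -/
structure CompletelyRegularlyPreordered (X : Type*) [TopologicalSpace X] [Preorder X] : Prop where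
  topology_eq : (inferInstance : TopologicalSpace X) =
    ⨅ f : X →Co unitInterval, TopologicalSpace.induced f inferInstance
  le_iff : ∀ x y : X, x ≤ y ↔ ∀ f : X →Co unitInterval, f x ≤ f y

/-- A preorder homeomorphism onto the image, the image having the induced topology and preorder. -/
structure IsPreorderEmbedding {X Y : Type*} [TopologicalSpace X] [Preorder X]
    [TopologicalSpace Y] [Preorder Y] (c : X → Y) : Prop where
  isEmbedding : IsEmbedding c
  le_iff : ∀ x y : X, c x ≤ c y ↔ x ≤ y

/-- A preorder compactification `c : X → Y`: a preorder embedding with dense image in a compact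
topological preordered space. -/
structure IsPreorderCompactification {X Y : Type*} [TopologicalSpace X] [Preorder X]
    [TopologicalSpace Y] [Preorder Y] (c : X → Y) : Prop where
  compact : CompactSpace Y
  embedding : IsPreorderEmbedding c
  dense : DenseRange c

/-- A Hausdorff `T₂`-preorder compactification: moreover `Y` is Hausdorff and the graph of its
preorder is closed in `Y × Y`. -/
structure IsHausdorffT2PreorderCompactification {X Y : Type*} [TopologicalSpace X] [Preorder X]
    [TopologicalSpace Y] [Preorder Y] (c : X → Y) : Prop
    extends IsPreorderCompactification c where
  t2 : T2Space Y
  closed_graph : IsClosed {p : Y × Y | p.1 ≤ p.2}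

/-- A `T₂`-order compactification: moreover the preorder of `Y` is an order. -/
structure IsT2OrderCompactification {X Y : Type*} [TopologicalSpace X] [Preorder X]
    [TopologicalSpace Y] [Preorder Y] (c : X → Y) : Prop
    extends IsHausdorffT2PreorderCompactification c where
  antisymm : ∀ a b : Y, a ≤ b → b ≤ a → a = b

/-- `c₂` dominates over `c₁` (written `c₁ ≤ c₂`): there is a continuous isotone `C : Y₂ → Y₁` with
`C ∘ c₂ = c₁`. -/
def DominatedBy {X Y₁ Y₂ : Type*} [TopologicalSpace Y₁] [Preorder Y₁]
    [TopologicalSpace Y₂] [Preorder Y₂] (c₁ : X → Y₁) (c₂ : X → Y₂) : Prop :=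
  ∃ C : Y₂ → Y₁, Continuous C ∧ Monotone C ∧ C ∘ c₂ = c₁

/-- Two preorder compactifications are equivalent if each dominates over the other. -/
def EquivalentCompactifications {X Y₁ Y₂ : Type*} [TopologicalSpace Y₁] [Preorder Y₁]
    [TopologicalSpace Y₂] [Preorder Y₂] (c₁ : X → Y₁) (c₂ : X → Y₂) : Prop :=
  DominatedBy c₁ c₂ ∧ DominatedBy c₂ c₁

/-- The order quotient `E/∼`, where `x ∼ y` means `x ≤ y` and `y ≤ x`.  Mathlib equips it with the
order `[x] ≲ [y] ↔ x ≤ y`. -/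
abbrev OrderQuotient (E : Type*) [Preorder E] : Type _ :=
  Antisymmetrization E (fun x y : E => x ≤ y)

/-- The quotient projection onto the order quotient. -/
def orderProj {E : Type*} [Preorder E] : E → OrderQuotient E :=
  toAntisymmetrization (fun x y : E => x ≤ y)

/-- The order quotient carries the quotient topology. -/
instance OrderQuotient.topologicalSpace (E : Type*) [TopologicalSpace E] [Preorder E] :
    TopologicalSpace (OrderQuotient E) :=
  TopologicalSpace.coinduced orderProj inferInstance

/-- The preorder `≤_β` on the Stone-Čech compactification: its graph is the intersection of the
graphs `{(a, b) | f̃ a ≤ f̃ b}`, where `f` runs over the continuous isotone functions `E → [0,1]`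
and `f̃` is the continuous extension of `f` to `βE`. -/
instance StoneCech.instPreorder (E : Type*) [TopologicalSpace E] [Preorder E] :
    Preorder (StoneCech E) where
  le a b := ∀ f : E →Co unitInterval,
    stoneCechExtend f.continuous_toFun a ≤ stoneCechExtend f.continuous_toFun b
  le_refl _ _ := le_rfl
  le_trans _ _ _ hab hbc f := (hab f).trans (hbc f)

theorem stoneCechUnit_monotone (E : Type*) [TopologicalSpace E] [Preorder E] :
    Monotone (stoneCechUnit : E → StoneCech E) := by
  intro x y hxy f
  rw [stoneCechExtend_stoneCechUnit, stoneCechExtend_stoneCechUnit]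
  exact f.monotone' hxy

/-- The map `Π ∘ β ∘ π⁻¹ : E/∼ → βE/∼_β`, sending the class of `x` to the class of `β x`. -/
def quotientStoneCechMap (E : Type*) [TopologicalSpace E] [Preorder E] :
    OrderQuotient E → OrderQuotient (StoneCech E) :=
  Quotient.lift (fun x : E => orderProj (stoneCechUnit x)) fun _ _ h =>
    Quotient.sound ⟨stoneCechUnit_monotone E h.1, stoneCechUnit_monotone E h.2⟩

/-- The evaluation map `x ↦ (f x)_f` into the cube indexed by the continuous isotone functions
`f : X → [0,1]`. -/
def nachbinEval (X : Type*) [TopologicalSpace X] [Preorder X] (x : X) :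
    (X →Co unitInterval) → unitInterval :=
  fun f => f x

/-- The space `nX` of Nachbin's compactification: the closure of the image of `X` in the cube,
with the topology and the order induced by the product topology and the product order. -/
abbrev Nachbin (X : Type*) [TopologicalSpace X] [Preorder X] : Type _ :=
  ↥(closure (Set.range (nachbinEval X)))

/-- The canonical map `n : X → nX`. -/
def nachbinUnit (X : Type*) [TopologicalSpace X] [Preorder X] (x : X) : Nachbin X :=
  ⟨nachbinEval X x, subset_closure ⟨x, rfl⟩⟩

/-!
The theorem holds because continuous isotone functions into `[0,1]` cannot see the difference
between `E` and `E/∼`: every such function on `E` factors through `π` as a continuous isotone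
function on `E/∼`, and conversely (`ContinuousOrderHom.exists_comp_orderProj`). Hence the evaluation
map `E → n(E/∼)` at the functions `g ∘ π` extends to a continuous map `K : βE → n(E/∼)`,
`K a = (g ↦ (g ∘ π)~ a)` (`stoneCechToNachbin`), and the definition of `≤_β` says precisely that
`a ≤_β b ↔ K a ≤ K b` (`stoneCechToNachbin_le_iff`). The image of `K` is compact and dense, so `K`
is onto. Passing to the quotient gives a continuous bijection `H : βE/∼_β → n(E/∼)`, isotone
together with its inverse, from a compact space to a Hausdorff space, hence a homeomorphism
(`orderQuotientStoneCechHomeo`), and `H ∘ φ = n` by construction.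

That `n` is a `T₂`-order compactification is a direct translation of complete regularity of the
order of `E/∼`: the initial topology makes `n` inducing, and the functions determining the order
make it an order embedding (`isT2OrderCompactification_nachbinUnit`). The corresponding statement
for `φ = H⁻¹ ∘ n` follows by transport along `H`
(`IsT2OrderCompactification.of_preorderHomeo`).
-/

/-! ### Continuous isotone functions on the order quotient -/

section OrderQuotient

theorem surjective_orderProj {E : Type*} [Preorder E] :
    Function.Surjective (orderProj : E → OrderQuotient E) :=
  Quotient.mk_surjective

theorem orderProj_le_orderProj {E : Type*} [Preorder E] {x y : E} :
    orderProj x ≤ orderProj y ↔ x ≤ y :=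
  Iff.rfl

variable {E : Type*} [TopologicalSpace E] [Preorder E]

theorem continuous_orderProj : Continuous (orderProj : E → OrderQuotient E) :=
  continuous_coinduced_rng

/-- The pullback `g ∘ π` of a continuous isotone function on the order quotient. -/
def ContinuousOrderHom.compOrderProj (g : OrderQuotient E →Co unitInterval) :
    E →Co unitInterval where
  toFun x := g (orderProj x)
  monotone' _ _ h := g.monotone' (orderProj_le_orderProj.2 h)
  continuous_toFun := g.continuous_toFun.comp continuous_orderProj

/-- Every continuous isotone function on `E` is constant on the classes of `∼`, so it is pulled
back from the order quotient. -/
theorem ContinuousOrderHom.exists_comp_orderProj (f : E →Co unitInterval) :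
    ∃ g : OrderQuotient E →Co unitInterval, g.compOrderProj = f := by
  refine ⟨⟨⟨Quotient.lift f fun x y h =>
    le_antisymm (f.monotone' h.1) (f.monotone' h.2), ?_⟩, ?_⟩, ?_⟩
  · intro p q
    induction p using Quotient.inductionOn
    induction q using Quotient.inductionOn
    exact fun h => f.monotone' h
  · exact continuous_coinduced_dom.2 f.continuous_toFun
  · ext x
    rfl

/-- If the order of `E/∼` is determined by continuous isotone functions, so is the preorder
of `E`. -/
theorem CompletelyRegularlyPreordered.le_iff_of_orderQuotient
    (h : CompletelyRegularlyPreordered (OrderQuotient E)) (x y : E) :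
    x ≤ y ↔ ∀ f : E →Co unitInterval, f x ≤ f y :=
  ⟨fun hxy f => f.monotone' hxy, fun hf =>
    orderProj_le_orderProj.1 ((h.le_iff _ _).2 fun g => hf g.compOrderProj)⟩

end OrderQuotient

/-! ### The Stone–Čech compactification of a preordered space -/

section StoneCech

variable {E : Type*} [TopologicalSpace E] [Preorder E]

theorem isClosed_graph_stoneCech : IsClosed {p : StoneCech E × StoneCech E | p.1 ≤ p.2} := by
  have : {p : StoneCech E × StoneCech E | p.1 ≤ p.2} = ⋂ f : E →Co unitInterval,
      {p | stoneCechExtend f.continuous_toFun p.1 ≤ stoneCechExtend f.continuous_toFun p.2} := by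
    ext p
    rw [Set.mem_iInter]
    rfl
  rw [this]
  exact isClosed_iInter fun f => isClosed_le
    ((continuous_stoneCechExtend _).comp continuous_fst)
    ((continuous_stoneCechExtend _).comp continuous_snd)

theorem isHausdorffT2PreorderCompactification_stoneCechUnit [T35Space E]
    (h : ∀ x y : E, x ≤ y ↔ ∀ f : E →Co unitInterval, f x ≤ f y) :
    IsHausdorffT2PreorderCompactification (stoneCechUnit : E → StoneCech E) where
  compact := inferInstance
  embedding :=
    { isEmbedding := isDenseEmbedding_stoneCechUnit.isEmbedding
      le_iff := fun x y => by
        refine ⟨fun hxy => (h x y).2 fun f => ?_, fun hxy => stoneCechUnit_monotone E hxy⟩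
        have := hxy f
        rwa [stoneCechExtend_stoneCechUnit, stoneCechExtend_stoneCechUnit] at this }
  dense := denseRange_stoneCechUnit
  t2 := inferInstance
  closed_graph := isClosed_graph_stoneCech

end StoneCech

/-! ### Nachbin's compactification -/

section Nachbin

variable {X : Type*} [TopologicalSpace X]

instance Nachbin.compactSpace [Preorder X] : CompactSpace (Nachbin X) :=
  isCompact_iff_compactSpace.1 isClosed_closure.isCompact

theorem denseRange_nachbinUnit [Preorder X] : DenseRange (nachbinUnit X) := by
  rintro ⟨p, hp⟩
  rw [closure_subtype, ← Set.range_comp]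
  exact hp

theorem isT2OrderCompactification_nachbinUnit [PartialOrder X]
    (h : CompletelyRegularlyPreordered X) : IsT2OrderCompactification (nachbinUnit X) where
  compact := inferInstance
  embedding := by
    have hle : ∀ x y : X, nachbinUnit X x ≤ nachbinUnit X y ↔ x ≤ y :=
      fun x y => (h.le_iff x y).symm
    have hind : IsInducing (nachbinEval X) := by
      refine ⟨h.topology_eq.trans ?_⟩
      simp only [Pi.topologicalSpace, induced_iInf, induced_compose]
      rfl
    refine ⟨⟨hind.codRestrict _, fun x y hxy => ?_⟩, hle⟩
    exact le_antisymm ((hle x y).1 hxy.le) ((hle y x).1 hxy.ge)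
  dense := denseRange_nachbinUnit
  t2 := inferInstance
  closed_graph := isClosed_le continuous_fst continuous_snd
  antisymm _ _ := le_antisymm

end Nachbin

/-! ### The comparison map -/

section Comparison

variable {E : Type*} [TopologicalSpace E] [Preorder E]

/-- The continuous map `βE → n(E/∼)` whose coordinate at a continuous isotone function `g` on `E/∼`
is the extension of `g ∘ π` to `βE`. It takes values in the closure of the image of `E/∼` by density
of `E` in `βE`. -/
noncomputable def stoneCechToNachbin (a : StoneCech E) : Nachbin (OrderQuotient E) :=
  ⟨fun g => stoneCechExtend g.compOrderProj.continuous_toFun a, by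
    have hc : Continuous fun (a : StoneCech E) (g : OrderQuotient E →Co unitInterval) =>
        stoneCechExtend g.compOrderProj.continuous_toFun a :=
      continuous_pi fun g => continuous_stoneCechExtend _
    refine map_mem_closure hc (denseRange_stoneCechUnit a) ?_
    rintro _ ⟨x, rfl⟩
    exact ⟨orderProj x, funext fun g =>
      (stoneCechExtend_stoneCechUnit g.compOrderProj.continuous_toFun x).symm⟩⟩

theorem continuous_stoneCechToNachbin :
    Continuous (stoneCechToNachbin : StoneCech E → Nachbin (OrderQuotient E)) :=
  (continuous_pi fun _ => continuous_stoneCechExtend _).subtype_mk _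

theorem stoneCechToNachbin_stoneCechUnit (x : E) :
    stoneCechToNachbin (stoneCechUnit x) = nachbinUnit (OrderQuotient E) (orderProj x) :=
  Subtype.ext (funext fun g => stoneCechExtend_stoneCechUnit g.compOrderProj.continuous_toFun x)

theorem stoneCechToNachbin_le_iff {a b : StoneCech E} :
    stoneCechToNachbin a ≤ stoneCechToNachbin b ↔ a ≤ b := by
  refine ⟨fun h f => ?_, fun h g => h g.compOrderProj⟩
  obtain ⟨g, rfl⟩ := f.exists_comp_orderProj
  exact h g

theorem surjective_stoneCechToNachbin :
    Function.Surjective (stoneCechToNachbin : StoneCech E → Nachbin (OrderQuotient E)) := by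
  have hdense : DenseRange (stoneCechToNachbin : StoneCech E → Nachbin (OrderQuotient E)) := by
    refine denseRange_nachbinUnit.mono ?_
    rintro _ ⟨q, rfl⟩
    obtain ⟨x, rfl⟩ := surjective_orderProj q
    exact ⟨_, stoneCechToNachbin_stoneCechUnit x⟩
  rw [← Set.range_eq_univ, ← hdense.closure_range]
  exact (isCompact_range continuous_stoneCechToNachbin).isClosed.closure_eq.symm

/-- The map `βE/∼_β → n(E/∼)` induced by `stoneCechToNachbin`. -/
noncomputable def orderQuotientStoneCechToNachbin :
    OrderQuotient (StoneCech E) → Nachbin (OrderQuotient E) :=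
  Quotient.lift stoneCechToNachbin fun _ _ h =>
    le_antisymm (stoneCechToNachbin_le_iff.2 h.1) (stoneCechToNachbin_le_iff.2 h.2)

theorem orderQuotientStoneCechToNachbin_le_iff (p q : OrderQuotient (StoneCech E)) :
    orderQuotientStoneCechToNachbin p ≤ orderQuotientStoneCechToNachbin q ↔ p ≤ q := by
  induction p using Quotient.inductionOn
  induction q using Quotient.inductionOn
  exact stoneCechToNachbin_le_iff

theorem continuous_orderQuotientStoneCechToNachbin :
    Continuous (orderQuotientStoneCechToNachbin (E := E)) :=
  continuous_coinduced_dom.2 continuous_stoneCechToNachbin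

theorem bijective_orderQuotientStoneCechToNachbin :
    Function.Bijective (orderQuotientStoneCechToNachbin (E := E)) := by
  refine ⟨fun p q h => ?_, fun y => ?_⟩
  · exact le_antisymm ((orderQuotientStoneCechToNachbin_le_iff p q).1 h.le)
      ((orderQuotientStoneCechToNachbin_le_iff q p).1 h.ge)
  · obtain ⟨a, rfl⟩ := surjective_stoneCechToNachbin y
    exact ⟨orderProj a, rfl⟩

instance OrderQuotient.compactSpace [CompactSpace E] : CompactSpace (OrderQuotient E) :=
  surjective_orderProj.compactSpace continuous_orderProj

/-- The homeomorphism `βE/∼_β ≃ n(E/∼)`. -/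
noncomputable def orderQuotientStoneCechHomeo :
    OrderQuotient (StoneCech E) ≃ₜ Nachbin (OrderQuotient E) :=
  Continuous.homeoOfEquivCompactToT2
    (f := Equiv.ofBijective _ bijective_orderQuotientStoneCechToNachbin)
    continuous_orderQuotientStoneCechToNachbin

theorem orderQuotientStoneCechHomeo_le_iff (p q : OrderQuotient (StoneCech E)) :
    orderQuotientStoneCechHomeo p ≤ orderQuotientStoneCechHomeo q ↔ p ≤ q :=
  orderQuotientStoneCechToNachbin_le_iff p q

theorem orderQuotientStoneCechHomeo_orderProj_stoneCechUnit (x : E) :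
    orderQuotientStoneCechHomeo (orderProj (stoneCechUnit x)) =
      nachbinUnit (OrderQuotient E) (orderProj x) :=
  stoneCechToNachbin_stoneCechUnit x

theorem orderQuotientStoneCechHomeo_quotientStoneCechMap (q : OrderQuotient E) :
    orderQuotientStoneCechHomeo (quotientStoneCechMap E q) = nachbinUnit (OrderQuotient E) q := by
  obtain ⟨x, rfl⟩ := surjective_orderProj q
  exact orderQuotientStoneCechHomeo_orderProj_stoneCechUnit x

end Comparison

/-! ### Transport of compactifications along preorder homeomorphisms -/

section Transport

variable {X Y Z : Type*} [TopologicalSpace Y] [Preorder Y] [TopologicalSpace Z] [Preorder Z]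
  {c₁ : X → Y} {c₂ : X → Z}

theorem IsT2OrderCompactification.of_preorderHomeo [TopologicalSpace X] [Preorder X]
    (h : IsT2OrderCompactification c₂) (H : Y ≃ₜ Z)
    (hle : ∀ a b, H a ≤ H b ↔ a ≤ b) (hc : ∀ x, H (c₁ x) = c₂ x) :
    IsT2OrderCompactification c₁ := by
  obtain rfl : H ∘ c₁ = c₂ := funext hc
  have := h.compact
  have := h.t2
  refine ⟨⟨⟨H.symm.compactSpace, ⟨?_, fun x y => ?_⟩, ?_⟩, H.symm.t2Space, ?_⟩,
    fun a b hab hba => ?_⟩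
  · exact H.isEmbedding.of_comp_iff.1 h.embedding.isEmbedding
  · exact (hle _ _).symm.trans (h.embedding.le_iff x y)
  · have := H.symm.surjective.denseRange.comp h.dense H.symm.continuous
    rwa [← Function.comp_assoc, H.symm_comp_self, Function.id_comp] at this
  · have := h.closed_graph.preimage (H.continuous.prodMap H.continuous)
    simpa only [Set.preimage_ofPred_eq, Prod.map_fst, Prod.map_snd, hle] using this
  · exact H.injective (h.antisymm _ _ ((hle a b).2 hab) ((hle b a).2 hba))

theorem EquivalentCompactifications.of_preorderHomeo (H : Y ≃ₜ Z)
    (hle : ∀ a b, H a ≤ H b ↔ a ≤ b) (hc : ∀ x, H (c₁ x) = c₂ x) :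
    EquivalentCompactifications c₁ c₂ := by
  refine ⟨⟨H.symm, H.symm.continuous, fun a b hab => ?_, funext fun x => ?_⟩,
    ⟨H, H.continuous, fun a b hab => (hle a b).2 hab, funext hc⟩⟩
  · rwa [← hle, H.apply_symm_apply, H.apply_symm_apply]
  · exact H.symm_apply_eq.2 (hc x).symm

end Transport

theorem mainTheorem5 (E : Type*) [TopologicalSpace E] [Preorder E] [T35Space E]
    (hclosed : IsClosed {p : E × E | p.1 ≤ p.2})
    (hquot : CompletelyRegularlyPreordered (OrderQuotient E)) :
    -- the preorder is represented by the continuous isotone functions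
    (∀ x y : E, x ≤ y ↔ ∀ f : E →Co unitInterval, f x ≤ f y) ∧
    -- `β` is a Hausdorff `T₂`-preorder compactification of `E`
    IsHausdorffT2PreorderCompactification (stoneCechUnit : E → StoneCech E) ∧
    -- the map `Π ∘ β ∘ π⁻¹` satisfies `(Π ∘ β ∘ π⁻¹) ∘ π = Π ∘ β`
    (∀ x : E, quotientStoneCechMap E (orderProj x) = orderProj (stoneCechUnit x)) ∧
    -- it is a `T₂`-order compactification of the order quotient, as is Nachbin's
    IsT2OrderCompactification (quotientStoneCechMap E) ∧
    IsT2OrderCompactification (nachbinUnit (OrderQuotient E)) ∧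
    -- and the two are equivalent
    EquivalentCompactifications (quotientStoneCechMap E) (nachbinUnit (OrderQuotient E)) ∧
    -- the square commutes up to a preorder homeomorphism `βE/∼_β → n(E/∼)`
    (∃ H : OrderQuotient (StoneCech E) ≃ₜ Nachbin (OrderQuotient E),
      (∀ a b, H a ≤ H b ↔ a ≤ b) ∧
      (∀ q : OrderQuotient E, H (quotientStoneCechMap E q) = nachbinUnit (OrderQuotient E) q) ∧
      (∀ x : E, H (orderProj (stoneCechUnit x)) =
        nachbinUnit (OrderQuotient E) (orderProj x))) := by
  have hn := isT2OrderCompactification_nachbinUnit hquot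
  have hE := hquot.le_iff_of_orderQuotient
  exact ⟨hE, isHausdorffT2PreorderCompactification_stoneCechUnit hE, fun _ => rfl,
    hn.of_preorderHomeo _ orderQuotientStoneCechHomeo_le_iff
      orderQuotientStoneCechHomeo_quotientStoneCechMap,
    hn,
    .of_preorderHomeo _ orderQuotientStoneCechHomeo_le_iff
      orderQuotientStoneCechHomeo_quotientStoneCechMap,
    orderQuotientStoneCechHomeo, orderQuotientStoneCechHomeo_le_iff,
    orderQuotientStoneCechHomeo_quotientStoneCechMap,
    orderQuotientStoneCechHomeo_orderProj_stoneCechUnit⟩
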